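/- **Definitions.** Write the standard basis of $\mathbb C^d\otimes\mathbb C^d$ as $|a\rangle\otimes|b\rangle$; the first factor belongs to Alice, the second to Bob. A state $\psi\in\mathbb C^d\otimes\mathbb C^d$ is maximally entangled if both partial traces of $|\psi\rangle\langle\psi|$ equal $\frac1d I_d$, and $|\Phi_d\rangle=d^{-1/2}\sum_j|j\rangle\otimes|j\rangle$. A measurement is a finite family of positive semidefinite operators with sum $I$; a measurement $(M_j)_{0\le j<k}$ perfectly distinguishes $\psi_0,\dots,\psi_{k-1}$ if $\langle\psi_i|M_j|\psi_i\rangle=\delta_{ij}$ for all $i,j$. It is a PPT measurement if $(I\otimes T)M_j\ge0$ for all $j$, where $T$ is the transpose. It is a one-way LOCC measurement if $M_j=\sum_x A_x\otimes B_{x,j}$ for all $j$, where $(A_x)_x$ is a measurement of Alice with finitely many outcomes and, for each $x$, $(B_{x,j})_j$ is a measurement of Bob. A qubit lattice state in $\mathbb C^{2^n}\otimes\mathbb C^{2^n}$ is a state $(I\otimes X)|\Phi_{2^n}\rangle$ where $X$ is a tensor product of $n$ Pauli matrices from $\{I,\sigma_x,\sigma_y,\sigma_z\}$. **Proposition.**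 For every $k\ge3$ and every $D$ there are a dimension $d\ge D$ and $k$ orthonormal maximally entangled states $\psi_0,\dots,\psi_{k-1}$ in $\mathbb C^d\otimes\mathbb C^d$ that can be perfectly distinguished by a PPT measurement but not by a one-way LOCC measurement. Moreover, the states can be taken of the following form. There are $n\ge 0$, $r\ge1$, $k$ pairwise distinct tensor products $X_0,\dots,X_{k-1}$ of $n$ Pauli matrices whose lattice states $(I\otimes X_i)|\Phi_{2^n}\rangle$ cannot be perfectly distinguished by a one-way LOCC measurement, and complex numbers $\alpha_0,\dots,\alpha_{k-1}$ of modulus one, such that $d=2^n+kr$ and $$\psi_i=(I\otimes U_i)|\Phi_d\rangle,\qquad U_i=\begin{pmatrix}\alpha_iX_i&0\\0&Q^i\end{pmatrix},\qquad Q=P\otimes I_r,$$ where $P=\sum_{j=0}^{k-1}|j+1\rangle\langle j|$ (addition modulo $k$) is the cyclic permutation matrix of size $k$. -/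

import Mathlib

open scoped Kronecker ComplexOrder

namespace LocalDiscrimination

noncomputable section

/-! ### States of a bipartite system

`ℂ^A ⊗ ℂ^B` is modelled as `EuclideanSpace ℂ (A × B)`: the coordinate at `(a, b)` is the
coefficient of `|a⟩ ⊗ |b⟩`, the first factor belongs to Alice and the second one to Bob. -/

/-- The projection `|ψ⟩⟨ψ|`. -/
def density {ι : Type*} (ψ : EuclideanSpace ℂ ι) : Matrix ι ι ℂ :=
  Matrix.of fun x y => ψ x * star (ψ y)

/-- Trace over Bob's factor. -/
def traceBob {A B : Type*} [Fintype B] (M : Matrix (A × B) (A × B) ℂ) : Matrix A A ℂ :=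
  Matrix.of fun a a' => ∑ b, M (a, b) (a', b)

/-- Trace over Alice's factor. -/
def traceAlice {A B : Type*} [Fintype A] (M : Matrix (A × B) (A × B) ℂ) : Matrix B B ℂ :=
  Matrix.of fun b b' => ∑ a, M (a, b) (a, b')

/-- A vector of `ℂ^d ⊗ ℂ^d` is a maximally entangled state if both of its reduced states are
maximally mixed, that is, equal to `I / d`. (For `d ≥ 1` this forces norm one.) -/
def IsMaximallyEntangled {ι : Type*} [Fintype ι] [DecidableEq ι]
    (ψ : EuclideanSpace ℂ (ι × ι)) : Prop :=
  traceBob (density ψ) = (Fintype.card ι : ℂ)⁻¹ • (1 : Matrix ι ι ℂ) ∧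
    traceAlice (density ψ) = (Fintype.card ι : ℂ)⁻¹ • (1 : Matrix ι ι ℂ)

/-- The standard maximally entangled state `|Φ_d⟩ = d^(-1/2) ∑ j, |j⟩ ⊗ |j⟩`. -/
def stdMaxEntangled (ι : Type*) [Fintype ι] [DecidableEq ι] : EuclideanSpace ℂ (ι × ι) :=
  WithLp.toLp 2 fun x => if x.1 = x.2 then ((Real.sqrt (Fintype.card ι) : ℝ) : ℂ)⁻¹ else 0

/-- The vector `(I ⊗ U)|Φ_d⟩`. -/
def stateOf {ι : Type*} [Fintype ι] [DecidableEq ι] (U : Matrix ι ι ℂ) :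
    EuclideanSpace ℂ (ι × ι) :=
  WithLp.toLp 2 (((1 : Matrix ι ι ℂ) ⊗ₖ U).mulVec (WithLp.ofLp (stdMaxEntangled ι)))

/-! ### Measurements -/

/-- A measurement (POVM) with outcomes in the finite type `κ`. -/
def IsMeasurement {κ ι : Type*} [Fintype κ] [Fintype ι] [DecidableEq ι]
    (M : κ → Matrix ι ι ℂ) : Prop :=
  (∀ x, (M x).PosSemidef) ∧ ∑ x, M x = 1

/-- `⟨ψ|M|ψ⟩`, the probability of the outcome with operator `M` in the state `ψ`. -/
def expectation {ι : Type*} [Fintype ι] (M : Matrix ι ι ℂ) (ψ : EuclideanSpace ℂ ι) : ℂ :=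
  star (WithLp.ofLp ψ) ⬝ᵥ M.mulVec (WithLp.ofLp ψ)

/-- The measurement `M` identifies each of the states `ψ i` with certainty. -/
def Distinguishes {κ ι : Type*} [DecidableEq κ] [Fintype ι]
    (M : κ → Matrix ι ι ℂ) (ψ : κ → EuclideanSpace ℂ ι) : Prop :=
  ∀ i j, expectation (M j) (ψ i) = if i = j then 1 else 0

/-- The partial transpose `(I ⊗ T) M`. -/
def partialTranspose {A B : Type*} (M : Matrix (A × B) (A × B) ℂ) :
    Matrix (A × B) (A × B) ℂ :=
  Matrix.of fun x y => M (x.1, y.2) (y.1, x.2)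

/-- Measurements all of whose operators have a positive partial transpose. -/
def IsPPTMeasurement {κ A B : Type*} [Fintype κ] [Fintype A] [Fintype B] [DecidableEq A]
    [DecidableEq B] (M : κ → Matrix (A × B) (A × B) ℂ) : Prop :=
  IsMeasurement M ∧ ∀ j, (partialTranspose (M j)).PosSemidef

/-- One-way LOCC measurements: Alice performs a measurement `S` with finitely many outcomes and
tells Bob her outcome `x`; Bob then performs a measurement `T x`, chosen depending on `x`, whose
outcome `j` is the result. The operator of the result `j` is `∑ x, S x ⊗ T x j`. -/
def IsOneWayLOCCMeasurement {κ A B : Type*} [Fintype κ] [Fintype A] [Fintype B] [DecidableEq A]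
    [DecidableEq B] (M : κ → Matrix (A × B) (A × B) ℂ) : Prop :=
  ∃ (N : ℕ) (S : Fin N → Matrix A A ℂ) (T : Fin N → κ → Matrix B B ℂ),
    IsMeasurement S ∧ (∀ x, IsMeasurement (T x)) ∧ ∀ j, M j = ∑ x, S x ⊗ₖ T x j

/-- Perfect distinguishability by PPT measurements. -/
def PPTDistinguishable {κ A B : Type*} [Fintype κ] [DecidableEq κ] [Fintype A] [Fintype B]
    [DecidableEq A] [DecidableEq B] (ψ : κ → EuclideanSpace ℂ (A × B)) : Prop :=
  ∃ M : κ → Matrix (A × B) (A × B) ℂ, IsPPTMeasurement M ∧ Distinguishes M ψ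

/-- Perfect distinguishability by one-way LOCC (from Alice to Bob). -/
def OneWayLOCCDistinguishable {κ A B : Type*} [Fintype κ] [DecidableEq κ] [Fintype A] [Fintype B]
    [DecidableEq A] [DecidableEq B] (ψ : κ → EuclideanSpace ℂ (A × B)) : Prop :=
  ∃ M : κ → Matrix (A × B) (A × B) ℂ, IsOneWayLOCCMeasurement M ∧ Distinguishes M ψ

/-! ### Lattice states and the block construction -/

/-- The four Pauli matrices `I, X, Y, Z`. -/
def pauli : Fin 4 → Matrix (Fin 2) (Fin 2) ℂ :=
  ![1, !![0, 1; 1, 0], !![0, -Complex.I; Complex.I, 0], !![1, 0; 0, -1]]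

/-- The tensor product of the `n` Pauli matrices with labels `p 0, …, p (n - 1)`, acting on
`(ℂ²)^{⊗ n}`, whose standard basis is indexed by `Fin n → Fin 2`. -/
def pauliString {n : ℕ} (p : Fin n → Fin 4) : Matrix (Fin n → Fin 2) (Fin n → Fin 2) ℂ :=
  Matrix.of fun a b => ∏ i, pauli (p i) (a i) (b i)

/-- The qubit lattice state `(I ⊗ X_p)|Φ_m⟩` in `ℂ^m ⊗ ℂ^m`, where `m = 2 ^ n`. -/
def latticeState {n : ℕ} (p : Fin n → Fin 4) :
    EuclideanSpace ℂ ((Fin n → Fin 2) × (Fin n → Fin 2)) :=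
  stateOf (pauliString p)

/-- The cyclic permutation matrix `P = ∑ j, |j + 1⟩⟨j|`, with addition modulo `k`. -/
def cyclicShift (k : ℕ) : Matrix (Fin k) (Fin k) ℂ :=
  Matrix.of fun a b => if (a : ℕ) = ((b : ℕ) + 1) % k then 1 else 0

/-- `Q = P ⊗ I_r`. -/
def cyclicBlock (k r : ℕ) : Matrix (Fin k × Fin r) (Fin k × Fin r) ℂ :=
  cyclicShift k ⊗ₖ (1 : Matrix (Fin r) (Fin r) ℂ)

/-- The identification of the basis of `(ℂ²)^{⊗ n} ⊕ (ℂ^k ⊗ ℂ^r)` with that of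
`ℂ^(2 ^ n + k * r)`. -/
def blockEquiv (n k r : ℕ) : (Fin n → Fin 2) ⊕ (Fin k × Fin r) ≃ Fin (2 ^ n + k * r) :=
  (Equiv.sumCongr finFunctionFinEquiv finProdFinEquiv).trans finSumFinEquiv

/-- The block diagonal matrix with diagonal blocks `α X_p` and `Q ^ i`, of size `2 ^ n + k * r`. -/
def blockUnitary {n : ℕ} (k r : ℕ) (α : Circle) (p : Fin n → Fin 4) (i : ℕ) :
    Matrix (Fin (2 ^ n + k * r)) (Fin (2 ^ n + k * r)) ℂ :=
  Matrix.reindex (blockEquiv n k r) (blockEquiv n k r)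
    (Matrix.fromBlocks ((α : ℂ) • pauliString p) 0 0 (cyclicBlock k r ^ i))

/-- For labels `p 0, …, p (k - 1)` of lattice states and phases `α`, the `k` vectors
`(I ⊗ U_i)|Φ_d⟩` of `ℂ^d ⊗ ℂ^d`, where `d = 2 ^ n + k * r` and `U_i` is block diagonal with
diagonal blocks `α_i X_{p i}` and `Q ^ i`. -/
def blockState {n : ℕ} (k r : ℕ) (α : Fin k → Circle) (p : Fin k → Fin n → Fin 4) (i : Fin k) :
    EuclideanSpace ℂ (Fin (2 ^ n + k * r) × Fin (2 ^ n + k * r)) :=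
  stateOf (blockUnitary k r (α i) (p i) (i : ℕ))

end

end LocalDiscrimination

namespace LocalDiscrimination
open Matrix

/-! ### States of the form `(I ⊗ U)|Φ⟩` -/

theorem stateOf_apply {ι : Type*} [Fintype ι] [DecidableEq ι] (U : Matrix ι ι ℂ) (x : ι × ι) :
    stateOf U x = ((Real.sqrt (Fintype.card ι) : ℝ) : ℂ)⁻¹ * U x.2 x.1 := by
  simp [stateOf, stdMaxEntangled, Matrix.mulVec, dotProduct, Fintype.sum_prod_type,
    Matrix.one_apply, mul_comm]

theorem inv_sqrt_card_mul_self (ι : Type*) [Fintype ι] :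
    ((Real.sqrt (Fintype.card ι) : ℝ) : ℂ)⁻¹ * ((Real.sqrt (Fintype.card ι) : ℝ) : ℂ)⁻¹ =
      (Fintype.card ι : ℂ)⁻¹ := by
  rw [← mul_inv, ← Complex.ofReal_mul, Real.mul_self_sqrt (Nat.cast_nonneg _)]
  simp

theorem stateOf_mul_star_stateOf {ι : Type*} [Fintype ι] [DecidableEq ι] (U V : Matrix ι ι ℂ)
    (x y : ι × ι) :
    stateOf U x * star (stateOf V y) =
      (Fintype.card ι : ℂ)⁻¹ * (U x.2 x.1 * star (V y.2 y.1)) := by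
  rw [stateOf_apply, stateOf_apply, ← inv_sqrt_card_mul_self]
  simp only [star_mul', star_inv₀, RCLike.star_def, Complex.conj_ofReal]
  ring

theorem inner_stateOf {ι : Type*} [Fintype ι] [DecidableEq ι] (U V : Matrix ι ι ℂ) :
    inner ℂ (stateOf U) (stateOf V) = (Fintype.card ι : ℂ)⁻¹ * (Uᴴ * V).trace := by
  rw [EuclideanSpace.inner_eq_star_dotProduct]
  simp only [dotProduct, Pi.star_apply, stateOf_mul_star_stateOf, ← Finset.mul_sum,
    Fintype.sum_prod_type, Matrix.trace, Matrix.diag, Matrix.mul_apply,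
    Matrix.conjTranspose_apply]
  congr 1
  exact Finset.sum_congr rfl fun a _ => Finset.sum_congr rfl fun b _ => mul_comm _ _

theorem orthonormal_stateOf {κ ι : Type*} [Fintype ι] [DecidableEq ι] [Nonempty ι]
    {U : κ → Matrix ι ι ℂ} (hU : ∀ i, (U i)ᴴ * U i = 1)
    (htr : ∀ i j, i ≠ j → ((U i)ᴴ * U j).trace = 0) :
    Orthonormal ℂ fun i => stateOf (U i) := by
  classical
  rw [orthonormal_iff_ite]
  intro i j
  rw [inner_stateOf]
  split_ifs with h
  · subst h
    simp [hU]
  · simp [htr i j h]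

theorem isMaximallyEntangled_stateOf {ι : Type*} [Fintype ι] [DecidableEq ι]
    {U : Matrix ι ι ℂ} (hU : Uᴴ * U = 1) : IsMaximallyEntangled (stateOf U) := by
  have hU' : U * Uᴴ = 1 := mul_eq_one_comm.mp hU
  constructor
  · ext a a'
    simp only [traceBob, density, Matrix.of_apply, stateOf_mul_star_stateOf, ← Finset.mul_sum,
      Matrix.smul_apply, smul_eq_mul]
    rw [← Matrix.transpose_one, ← hU]
    simp [Matrix.mul_apply, mul_comm]
  · ext b b'
    simp only [traceAlice, density, Matrix.of_apply, stateOf_mul_star_stateOf, ← Finset.mul_sum,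
      Matrix.smul_apply, smul_eq_mul]
    rw [← hU']
    simp [Matrix.mul_apply]

/-! ### The expectation value -/

section Expectation

variable {ι : Type*} [Fintype ι]

theorem expectation_add (M N : Matrix ι ι ℂ) (ψ : EuclideanSpace ℂ ι) :
    expectation (M + N) ψ = expectation M ψ + expectation N ψ := by
  simp [expectation, Matrix.add_mulVec]

theorem expectation_sub (M N : Matrix ι ι ℂ) (ψ : EuclideanSpace ℂ ι) :
    expectation (M - N) ψ = expectation M ψ - expectation N ψ := by
  simp [expectation, Matrix.sub_mulVec]

theorem expectation_smul (c : ℂ) (M : Matrix ι ι ℂ) (ψ : EuclideanSpace ℂ ι) :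
    expectation (c • M) ψ = c * expectation M ψ := by
  simp [expectation, Matrix.smul_mulVec]

theorem expectation_sum {κ : Type*} (s : Finset κ) (M : κ → Matrix ι ι ℂ)
    (ψ : EuclideanSpace ℂ ι) :
    expectation (∑ x ∈ s, M x) ψ = ∑ x ∈ s, expectation (M x) ψ := by
  simp [expectation, Matrix.sum_mulVec, dotProduct_sum]

theorem expectation_one [DecidableEq ι] (ψ : EuclideanSpace ℂ ι) :
    expectation 1 ψ = inner ℂ ψ ψ := by
  rw [EuclideanSpace.inner_eq_star_dotProduct, dotProduct_comm]
  simp [expectation]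

theorem density_eq_vecMulVec {ι : Type*} (ψ : EuclideanSpace ℂ ι) :
    density ψ = vecMulVec (WithLp.ofLp ψ) (star (WithLp.ofLp ψ)) := rfl

theorem expectation_density (φ ψ : EuclideanSpace ℂ ι) :
    expectation (density φ) ψ = inner ℂ ψ φ * inner ℂ φ ψ := by
  rw [EuclideanSpace.inner_eq_star_dotProduct, EuclideanSpace.inner_eq_star_dotProduct,
    expectation, density_eq_vecMulVec, Matrix.vecMulVec_mulVec, dotProduct_comm]
  simp [dotProduct_comm, mul_comm]

theorem density_posSemidef (ψ : EuclideanSpace ℂ ι) : (density ψ).PosSemidef := by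
  rw [density_eq_vecMulVec]
  exact Matrix.posSemidef_vecMulVec_self_star _

theorem density_mul_density (φ ψ : EuclideanSpace ℂ ι) :
    density φ * density ψ =
      (inner ℂ φ ψ : ℂ) • vecMulVec (WithLp.ofLp φ) (star (WithLp.ofLp ψ)) := by
  rw [EuclideanSpace.inner_eq_star_dotProduct, density_eq_vecMulVec, density_eq_vecMulVec,
    Matrix.vecMulVec_mul_vecMulVec, dotProduct_comm]
  ext a b
  simp [vecMulVec_apply, mul_left_comm]

end Expectation

/-! ### Perfect discrimination of few maximally entangled states by PPT measurements -/

theorem posSemidef_of_mul_self_eq_smul {ι : Type*} [Fintype ι] {M : Matrix ι ι ℂ}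
    (hM : M.IsHermitian) {c : ℝ} (hc : 0 < c) (h : M * M = (c : ℂ) • M) : M.PosSemidef := by
  have hM' : M = ((c : ℂ)⁻¹) • (Mᴴ * M) := by
    rw [hM.eq, h, smul_smul, inv_mul_cancel₀ (by exact_mod_cast hc.ne'), one_smul]
  rw [hM']
  refine (Matrix.posSemidef_conjTranspose_mul_self M).smul ?_
  rw [← Complex.ofReal_inv]
  exact_mod_cast (inv_pos.mpr hc).le

theorem posSemidef_one_sub_sum_density {κ ι : Type*} [Fintype κ] [Fintype ι]
    [DecidableEq ι] {ψ : κ → EuclideanSpace ℂ ι} (hψ : Orthonormal ℂ ψ) :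
    (1 - ∑ i, density (ψ i)).PosSemidef := by
  classical
  have hP : (∑ i, density (ψ i)) * (∑ i, density (ψ i)) = ∑ i, density (ψ i) := by
    simp only [Finset.sum_mul, Finset.mul_sum, density_mul_density, orthonormal_iff_ite.mp hψ,
      ite_smul, one_smul, zero_smul, Finset.sum_ite_eq', Finset.mem_univ,
      if_true]
    rfl
  refine posSemidef_of_mul_self_eq_smul (c := 1) ?_ one_pos ?_
  · exact Matrix.isHermitian_one.sub
      (Matrix.posSemidef_sum _ fun i _ => density_posSemidef (ψ i)).isHermitian
  · rw [sub_mul, mul_sub, mul_sub, hP]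
    simp

section PartialTranspose

variable {A B : Type*}

theorem partialTranspose_add (M N : Matrix (A × B) (A × B) ℂ) :
    partialTranspose (M + N) = partialTranspose M + partialTranspose N := rfl

theorem partialTranspose_sub (M N : Matrix (A × B) (A × B) ℂ) :
    partialTranspose (M - N) = partialTranspose M - partialTranspose N := rfl

theorem partialTranspose_smul (c : ℂ) (M : Matrix (A × B) (A × B) ℂ) :
    partialTranspose (c • M) = c • partialTranspose M := rfl

theorem partialTranspose_sum {κ : Type*} (s : Finset κ) (M : κ → Matrix (A × B) (A × B) ℂ) :
    partialTranspose (∑ i ∈ s, M i) = ∑ i ∈ s, partialTranspose (M i) := by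
  ext x y
  simp [partialTranspose, Matrix.sum_apply]

theorem partialTranspose_one [DecidableEq A] [DecidableEq B] :
    partialTranspose (1 : Matrix (A × B) (A × B) ℂ) = 1 := by
  ext x y
  simp only [partialTranspose, Matrix.of_apply, Matrix.one_apply, Prod.ext_iff]
  congr 1
  simp [eq_comm]

end PartialTranspose

/-- The partial transpose of `|Φ_U⟩⟨Φ_U|`, multiplied by the dimension: the flip operator
twisted by `U`. -/
def twistedFlip {ι : Type*} (U : Matrix ι ι ℂ) : Matrix (ι × ι) (ι × ι) ℂ :=
  Matrix.of fun x y => U y.2 x.1 * star (U x.2 y.1)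

theorem partialTranspose_density_stateOf {ι : Type*} [Fintype ι] [DecidableEq ι]
    (U : Matrix ι ι ℂ) :
    partialTranspose (density (stateOf U)) = (Fintype.card ι : ℂ)⁻¹ • twistedFlip U := by
  ext x y
  simp only [partialTranspose, density, twistedFlip, Matrix.of_apply, stateOf_mul_star_stateOf,
    Matrix.smul_apply, smul_eq_mul]

theorem isHermitian_twistedFlip {ι : Type*} (U : Matrix ι ι ℂ) :
    (twistedFlip U).IsHermitian := by
  ext x y
  simp [twistedFlip, mul_comm]

theorem twistedFlip_mul_self {ι : Type*} [Fintype ι] [DecidableEq ι] {U : Matrix ι ι ℂ}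
    (hU : Uᴴ * U = 1) : twistedFlip U * twistedFlip U = 1 := by
  have hU' : U * Uᴴ = 1 := mul_eq_one_comm.mp hU
  ext ⟨a, b⟩ ⟨a', b'⟩
  have h1 : (Uᴴ * U) a' a * (U * Uᴴ) b' b =
      (twistedFlip U * twistedFlip U) (a, b) (a', b') := by
    simp only [Matrix.mul_apply, Fintype.sum_prod_type, twistedFlip, Matrix.of_apply,
      Matrix.conjTranspose_apply, Finset.sum_mul_sum]
    rw [Finset.sum_comm]
    refine Finset.sum_congr rfl fun x _ => Finset.sum_congr rfl fun y _ => ?_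
    ring
  rw [← h1, hU, hU']
  by_cases ha : a = a' <;> by_cases hb : b = b' <;>
    simp [Matrix.one_apply, ha, hb, eq_comm, Prod.ext_iff]

theorem posSemidef_one_add_twistedFlip {ι : Type*} [Fintype ι] [DecidableEq ι]
    {U : Matrix ι ι ℂ} (hU : Uᴴ * U = 1) : (1 + twistedFlip U).PosSemidef := by
  refine posSemidef_of_mul_self_eq_smul (c := 2)
    (Matrix.isHermitian_one.add (isHermitian_twistedFlip U)) two_pos ?_
  rw [add_mul, mul_add, mul_add, twistedFlip_mul_self hU, Complex.ofReal_ofNat, two_smul]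
  simp only [mul_one, one_mul]
  abel

theorem posSemidef_one_sub_twistedFlip {ι : Type*} [Fintype ι] [DecidableEq ι]
    {U : Matrix ι ι ℂ} (hU : Uᴴ * U = 1) : (1 - twistedFlip U).PosSemidef := by
  refine posSemidef_of_mul_self_eq_smul (c := 2)
    (Matrix.isHermitian_one.sub (isHermitian_twistedFlip U)) two_pos ?_
  rw [sub_mul, mul_sub, mul_sub, twistedFlip_mul_self hU, Complex.ofReal_ofNat, two_smul]
  simp only [mul_one, one_mul]
  abel

/-- `k` orthonormal states `(I ⊗ U_i)|Φ_d⟩` with `U_i` unitary are perfectly distinguished by a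
PPT measurement as soon as `2 * k ≤ d`. -/
theorem pptDistinguishable_stateOf {κ ι : Type*} [Fintype κ] [DecidableEq κ] [Nonempty κ]
    [Fintype ι] [DecidableEq ι] {U : κ → Matrix ι ι ℂ} (hU : ∀ i, (U i)ᴴ * U i = 1)
    (hψ : Orthonormal ℂ fun i => stateOf (U i))
    (hcard : 2 * Fintype.card κ ≤ Fintype.card ι) :
    PPTDistinguishable fun i => stateOf (U i) := by
  have hk : 0 < Fintype.card κ := Fintype.card_pos
  have hk0 : (Fintype.card κ : ℂ) ≠ 0 := by exact_mod_cast hk.ne'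
  have hk' : (0 : ℂ) ≤ (Fintype.card κ : ℂ)⁻¹ := by positivity
  have hd' : (0 : ℂ) ≤ (Fintype.card ι : ℂ)⁻¹ := by positivity
  have hgap : (0 : ℂ) ≤ (Fintype.card κ : ℂ)⁻¹ - 2 * (Fintype.card ι : ℂ)⁻¹ := by
    have : (0 : ℝ) ≤ (Fintype.card κ : ℝ)⁻¹ - 2 * (Fintype.card ι : ℝ)⁻¹ := by
      have hkR : (0 : ℝ) < Fintype.card κ := by exact_mod_cast hk
      have hcR : (2 : ℝ) * Fintype.card κ ≤ Fintype.card ι := by exact_mod_cast hcard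
      rw [sub_nonneg, ← div_eq_mul_inv, div_le_iff₀ (by linarith), inv_mul_eq_div,
        le_div_iff₀ hkR]
      exact hcR
    simpa using Complex.zero_le_real.mpr this
  refine ⟨fun j => (Fintype.card κ : ℂ)⁻¹ • (1 - ∑ i, density (stateOf (U i))) +
    density (stateOf (U j)), ⟨⟨fun j => ?_, ?_⟩, fun j => ?_⟩, fun i j => ?_⟩
  · exact ((posSemidef_one_sub_sum_density hψ).smul hk').add (density_posSemidef _)
  · rw [Finset.sum_add_distrib, Finset.sum_const, Finset.card_univ, ← Nat.cast_smul_eq_nsmul ℂ,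
      smul_smul, mul_inv_cancel₀ hk0, one_smul, sub_add_cancel]
  · have key : partialTranspose ((Fintype.card κ : ℂ)⁻¹ • (1 - ∑ i, density (stateOf (U i))) +
        density (stateOf (U j))) =
        ((Fintype.card κ : ℂ)⁻¹ - 2 * (Fintype.card ι : ℂ)⁻¹) • 1 +
        ((Fintype.card ι : ℂ)⁻¹ • (1 + twistedFlip (U j)) +
        (Fintype.card κ : ℂ)⁻¹ • (Fintype.card ι : ℂ)⁻¹ • ∑ i, (1 - twistedFlip (U i))) := by
      simp only [partialTranspose_add, partialTranspose_sub, partialTranspose_smul,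
        partialTranspose_sum, partialTranspose_one, partialTranspose_density_stateOf,
        Finset.sum_sub_distrib, Finset.sum_const, Finset.card_univ, ← Nat.cast_smul_eq_nsmul ℂ,
        ← Finset.smul_sum]
      ext x y
      simp only [Matrix.add_apply, Matrix.sub_apply, Matrix.smul_apply, smul_eq_mul]
      field_simp
      ring
    rw [key]
    refine (Matrix.PosSemidef.one.smul hgap).add
      (((posSemidef_one_add_twistedFlip (hU j)).smul hd').add (Matrix.PosSemidef.smul
        (Matrix.PosSemidef.smul (Matrix.posSemidef_sum _ fun i _ =>
          posSemidef_one_sub_twistedFlip (hU i)) hd') hk'))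
  · rw [expectation_add, expectation_smul, expectation_sub, expectation_sum, expectation_one]
    simp only [expectation_density, orthonormal_iff_ite.mp hψ]
    by_cases h : i = j <;> simp [h, eq_comm]

/-! ### Obstructions to one-way LOCC discrimination -/

theorem kronecker_mulVec_stateOf {ι : Type*} [Fintype ι] [DecidableEq ι] (S T U : Matrix ι ι ℂ)
    (a b : ι) :
    ((S ⊗ₖ T) *ᵥ WithLp.ofLp (stateOf U)) (a, b) =
      ((Real.sqrt (Fintype.card ι) : ℝ) : ℂ)⁻¹ * (T * U * Sᵀ) b a := by
  simp only [Matrix.mulVec, dotProduct, Fintype.sum_prod_type, stateOf_apply,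
    Matrix.kroneckerMap_apply, Matrix.mul_apply, Matrix.transpose_apply, Finset.sum_mul,
    Finset.mul_sum]
  refine Finset.sum_congr rfl fun x _ => Finset.sum_congr rfl fun y _ => ?_
  ring

theorem mul_mul_transpose_eq_zero_of_expectation_eq_zero {ι : Type*} [Fintype ι] [DecidableEq ι]
    [Nonempty ι] {S T U : Matrix ι ι ℂ} (hS : S.PosSemidef) (hT : T.PosSemidef)
    (h : expectation (S ⊗ₖ T) (stateOf U) = 0) : T * U * Sᵀ = 0 := by
  have h0 := ((hS.kronecker hT).dotProduct_mulVec_zero_iff _).mp h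
  ext b a
  have h1 := congrFun h0 (a, b)
  rw [kronecker_mulVec_stateOf] at h1
  have hc : ((Real.sqrt (Fintype.card ι) : ℝ) : ℂ)⁻¹ ≠ 0 := by
    simp
  simpa using (mul_eq_zero.mp h1).resolve_left hc

/-- If a one-way LOCC measurement distinguishes the states `(I ⊗ U_i)|Φ⟩`, then any vector in the
range of the transpose of one of Alice's operators is mapped to orthogonal vectors by the `U_i`.
So there is no such measurement if all vectors with this property have a common zero
coordinate. -/
theorem not_oneWayLOCCDistinguishable_stateOf {κ ι : Type*} [Fintype κ] [DecidableEq κ]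
    [Fintype ι] [DecidableEq ι] {U : κ → Matrix ι ι ℂ} (a : ι)
    (h : ∀ φ : ι → ℂ, (∀ i j, i ≠ j → star (U i *ᵥ φ) ⬝ᵥ (U j *ᵥ φ) = 0) → φ a = 0) :
    ¬ OneWayLOCCDistinguishable fun i => stateOf (U i) := by
  rintro ⟨M, ⟨N, S, T, hS, hT, hM⟩, hdist⟩
  have : Nonempty ι := ⟨a⟩
  have hzero (x : Fin N) (i j : κ) (hij : i ≠ j) : T x j * U i * (S x)ᵀ = 0 := by
    have hsum := hdist i j
    have hnonneg : ∀ y ∈ Finset.univ, 0 ≤ expectation (S y ⊗ₖ T y j) (stateOf (U i)) := fun y _ =>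
      ((hS.1 y).kronecker ((hT y).1 j)).dotProduct_mulVec_nonneg _
    rw [hM, if_neg hij, expectation_sum, Finset.sum_eq_zero_iff_of_nonneg hnonneg] at hsum
    exact mul_mul_transpose_eq_zero_of_expectation_eq_zero (hS.1 x) ((hT x).1 j)
      (hsum x (Finset.mem_univ x))
  have hfix (x : Fin N) (i : κ) : T x i * U i * (S x)ᵀ = U i * (S x)ᵀ := by
    have hsum : ∑ j, T x j * U i * (S x)ᵀ = U i * (S x)ᵀ := by
      rw [← Finset.sum_mul, ← Finset.sum_mul, (hT x).2, one_mul]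
    rw [← hsum]
    exact (Finset.sum_eq_single i (fun j _ hj => hzero x i j hj.symm) (by simp)).symm
  have horth (x : Fin N) (i j : κ) (hij : i ≠ j) :
      (U i * (S x)ᵀ)ᴴ * (U j * (S x)ᵀ) = 0 := by
    rw [← hfix x j, mul_assoc (T x j), ← mul_assoc _ (T x j),
      ← ((hT x).1 j).isHermitian.eq, ← Matrix.conjTranspose_mul, ← mul_assoc (T x j), hzero x i j hij]
    simp
  have hdiag (x : Fin N) : S x a a = 0 := by
    have := h ((S x)ᵀ *ᵥ Pi.single a 1) fun i j hij => by
      rw [Matrix.mulVec_mulVec, Matrix.mulVec_mulVec, Matrix.star_mulVec,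
        ← Matrix.dotProduct_mulVec, Matrix.mulVec_mulVec, horth x i j hij]
      simp
    simpa using this
  have h1 := congrFun (congrFun hS.2 a) a
  simp [Matrix.sum_apply, hdiag] at h1

/-- Too many unitaries cannot map a nonzero vector to pairwise orthogonal vectors. -/
theorem eq_zero_of_orthogonal_of_card_lt {κ ι : Type*} [Fintype κ] [Fintype ι] [DecidableEq ι]
    (hcard : Fintype.card ι < Fintype.card κ) {U : κ → Matrix ι ι ℂ} (hU : ∀ i, (U i)ᴴ * U i = 1)
    {φ : ι → ℂ} (hφ : ∀ i j, i ≠ j → star (U i *ᵥ φ) ⬝ᵥ (U j *ᵥ φ) = 0) : φ = 0 := by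
  by_contra hne
  have hli : LinearIndependent ℂ fun i =>
      (WithLp.toLp 2 (U i *ᵥ φ) : EuclideanSpace ℂ ι) := by
    refine linearIndependent_of_ne_zero_of_inner_eq_zero (𝕜 := ℂ) (fun i hi => hne ?_)
      fun i j hij => ?_
    · have h0 : U i *ᵥ φ = 0 := by simpa using hi
      rw [← Matrix.one_mulVec φ, ← hU i, ← Matrix.mulVec_mulVec, h0, Matrix.mulVec_zero]
    · beta_reduce
      rw [EuclideanSpace.inner_eq_star_dotProduct, dotProduct_comm]
      exact hφ i j hij
  have := hli.fintype_card_le_finrank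
  rw [finrank_euclideanSpace] at this
  omega

/-! ### Pauli matrices -/

theorem pauli_conjTranspose (p : Fin 4) : (pauli p)ᴴ = pauli p := by
  fin_cases p <;> ext a b <;> fin_cases a <;> fin_cases b <;> simp [pauli]

theorem pauli_mul_self (p : Fin 4) : pauli p * pauli p = 1 := by
  fin_cases p <;> ext a b <;> fin_cases a <;> fin_cases b <;> simp [pauli]

theorem exists_sign_pauli_mul_pauli (p q : Fin 4) :
    ∃ ε : ℂ, ε * ε = 1 ∧ pauli p * pauli q = ε • (pauli q * pauli p) := by
  have h (p q : Fin 4) : pauli p * pauli q = (1 : ℂ) • (pauli q * pauli p) ∨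
      pauli p * pauli q = (-1 : ℂ) • (pauli q * pauli p) := by
    fin_cases p <;> fin_cases q <;> simp [pauli]
  rcases h p q with h | h
  · exact ⟨1, by simp, h⟩
  · exact ⟨-1, by simp, h⟩

theorem trace_pauli_mul_pauli {p q : Fin 4} (h : p ≠ q) : (pauli p * pauli q).trace = 0 := by
  fin_cases p <;> fin_cases q <;> first | exact absurd rfl h | simp [pauli, Matrix.trace_fin_two]

section PauliString

variable {n : ℕ}

theorem pauliString_conjTranspose (p : Fin n → Fin 4) : (pauliString p)ᴴ = pauliString p := by
  ext a b
  rw [Matrix.conjTranspose_apply]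
  simp only [pauliString, Matrix.of_apply, star_prod]
  exact Finset.prod_congr rfl fun i _ =>
    congrFun (congrFun (pauli_conjTranspose (p i)) (a i)) (b i)

theorem pauliString_mul_apply (p q : Fin n → Fin 4) (a b : Fin n → Fin 2) :
    (pauliString p * pauliString q) a b = ∏ i, (pauli (p i) * pauli (q i)) (a i) (b i) := by
  simp only [Matrix.mul_apply, pauliString, Matrix.of_apply, Fintype.prod_sum,
    Finset.prod_mul_distrib]

theorem pauliString_mul_self (p : Fin n → Fin 4) : pauliString p * pauliString p = 1 := by
  ext a b
  simp only [pauliString_mul_apply, pauli_mul_self, Matrix.one_apply]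
  rw [Finset.prod_ite_zero]
  simp [funext_iff]

theorem pauliString_unitary (p : Fin n → Fin 4) : (pauliString p)ᴴ * pauliString p = 1 := by
  rw [pauliString_conjTranspose, pauliString_mul_self]

theorem exists_sign_pauliString_mul_pauliString (p q : Fin n → Fin 4) :
    ∃ ε : ℂ, ε * ε = 1 ∧
      pauliString p * pauliString q = ε • (pauliString q * pauliString p) := by
  choose ε hε h using fun i => exists_sign_pauli_mul_pauli (p i) (q i)
  refine ⟨∏ i, ε i, ?_, ?_⟩
  · simp only [← Finset.prod_mul_distrib, hε, Finset.prod_const_one]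
  · ext a b
    simp only [pauliString_mul_apply, h, Matrix.smul_apply, smul_eq_mul, Finset.prod_mul_distrib]

theorem trace_pauliString_mul_pauliString {p q : Fin n → Fin 4} (h : p ≠ q) :
    (pauliString p * pauliString q).trace = 0 := by
  obtain ⟨i, hi⟩ := Function.ne_iff.mp h
  have : (pauliString p * pauliString q).trace = ∏ i, (pauli (p i) * pauli (q i)).trace := by
    simp only [Matrix.trace, Matrix.diag, pauliString_mul_apply, Fintype.prod_sum]
  rw [this]
  exact Finset.prod_eq_zero (Finset.mem_univ i) (trace_pauli_mul_pauli hi)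

/-- Overlaps of the images of a vector under two Pauli strings are real or purely imaginary. -/
theorem star_overlap_mul_self (p q : Fin n → Fin 4) (u : (Fin n → Fin 2) → ℂ) :
    star (star (pauliString p *ᵥ u) ⬝ᵥ (pauliString q *ᵥ u)) *
        star (star (pauliString p *ᵥ u) ⬝ᵥ (pauliString q *ᵥ u)) =
      (star (pauliString p *ᵥ u) ⬝ᵥ (pauliString q *ᵥ u)) *
        (star (pauliString p *ᵥ u) ⬝ᵥ (pauliString q *ᵥ u)) := by
  obtain ⟨ε, hε, h⟩ := exists_sign_pauliString_mul_pauliString q p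
  have key (p q : Fin n → Fin 4) : star (pauliString p *ᵥ u) ⬝ᵥ (pauliString q *ᵥ u) =
      star u ⬝ᵥ ((pauliString p * pauliString q) *ᵥ u) := by
    rw [Matrix.star_mulVec, ← Matrix.dotProduct_mulVec, Matrix.mulVec_mulVec,
      pauliString_conjTranspose]
  have hstar : star (star (pauliString p *ᵥ u) ⬝ᵥ (pauliString q *ᵥ u)) =
      ε * (star (pauliString p *ᵥ u) ⬝ᵥ (pauliString q *ᵥ u)) := by
    rw [← Matrix.star_dotProduct, key, key, h, Matrix.smul_mulVec, dotProduct_smul,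
      smul_eq_mul]
  rw [hstar, mul_mul_mul_comm, hε, one_mul]

end PauliString

/-- If there are more lattice states than the local dimension, they cannot be perfectly
distinguished by one-way LOCC. -/
theorem not_oneWayLOCCDistinguishable_latticeState {κ : Type*} [Fintype κ] [DecidableEq κ]
    {n : ℕ} (hcard : 2 ^ n < Fintype.card κ) (p : κ → Fin n → Fin 4) :
    ¬ OneWayLOCCDistinguishable fun i => latticeState (p i) := by
  refine not_oneWayLOCCDistinguishable_stateOf (U := fun i => pauliString (p i)) 0
    fun φ hφ => ?_
  rw [eq_zero_of_orthogonal_of_card_lt (by simpa using hcard)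
    (fun i => pauliString_unitary (p i)) hφ, Pi.zero_apply]

/-! ### Powers of the cyclic shift -/

theorem cyclicShift_pow_apply (k m : ℕ) (a b : Fin k) :
    (cyclicShift k ^ m) a b = if (a : ℕ) = ((b : ℕ) + m) % k then 1 else 0 := by
  have hk : 0 < k := a.pos
  induction m generalizing a with
  | zero => simp [Matrix.one_apply, Nat.mod_eq_of_lt b.isLt, Fin.ext_iff]
  | succ m ih =>
    rw [pow_succ', Matrix.mul_apply, Finset.sum_eq_single ⟨((b : ℕ) + m) % k, Nat.mod_lt _ hk⟩]
    · rw [ih]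
      simp [cyclicShift, add_assoc]
    · intro c _ hc
      rw [ih, if_neg fun h => hc (Fin.ext h), mul_zero]
    · simp

theorem cyclicShift_pow_self (k : ℕ) : cyclicShift k ^ k = 1 := by
  ext a b
  simp [cyclicShift_pow_apply, Matrix.one_apply, Nat.mod_eq_of_lt b.isLt, Fin.ext_iff]

theorem trace_cyclicShift_pow {k m : ℕ} (hm : 0 < m) (hmk : m < k) :
    (cyclicShift k ^ m).trace = 0 := by
  refine Finset.sum_eq_zero fun a _ => ?_
  rw [Matrix.diag_apply, cyclicShift_pow_apply, if_neg]
  intro h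
  have ha := a.isLt
  rcases lt_or_ge ((a : ℕ) + m) k with h' | h'
  · rw [Nat.mod_eq_of_lt h'] at h
    omega
  · rw [Nat.mod_eq_sub_mod h', Nat.mod_eq_of_lt (by omega)] at h
    omega

theorem cyclicShift_unitary (k : ℕ) : (cyclicShift k)ᴴ * cyclicShift k = 1 := by
  ext a b
  have hk : 0 < k := a.pos
  rw [Matrix.mul_apply, Finset.sum_eq_single ⟨((b : ℕ) + 1) % k, Nat.mod_lt _ hk⟩]
  · have hab : ((b : ℕ) + 1) % k = ((a : ℕ) + 1) % k ↔ a = b := by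
      rw [Fin.ext_iff, ← Nat.ModEq, Nat.ModEq.comm]
      constructor
      · intro h
        simpa [Nat.ModEq, Nat.mod_eq_of_lt] using Nat.ModEq.add_right_cancel' 1 h
      · intro h
        rw [h]
    simp [cyclicShift, Matrix.one_apply, hab]
  · intro c _ hc
    have : (c : ℕ) ≠ ((b : ℕ) + 1) % k := fun h => hc (Fin.ext h)
    simp [cyclicShift, this]
  · simp

theorem cyclicBlock_pow (k r m : ℕ) :
    cyclicBlock k r ^ m = (cyclicShift k ^ m) ⊗ₖ (1 : Matrix (Fin r) (Fin r) ℂ) := by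
  induction m with
  | zero => simp
  | succ m ih =>
    rw [pow_succ, ih, cyclicBlock, ← Matrix.mul_kronecker_mul, ← pow_succ, mul_one]

theorem cyclicBlock_pow_self (k r : ℕ) : cyclicBlock k r ^ k = 1 := by
  rw [cyclicBlock_pow, cyclicShift_pow_self, Matrix.one_kronecker_one]

theorem trace_cyclicBlock_pow {k m : ℕ} (r : ℕ) (hm : 0 < m) (hmk : m < k) :
    (cyclicBlock k r ^ m).trace = 0 := by
  rw [cyclicBlock_pow, Matrix.trace_kronecker, trace_cyclicShift_pow hm hmk, zero_mul]

theorem cyclicBlock_unitary (k r : ℕ) : (cyclicBlock k r)ᴴ * cyclicBlock k r = 1 := by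
  rw [cyclicBlock, Matrix.conjTranspose_kronecker, ← Matrix.mul_kronecker_mul,
    cyclicShift_unitary, Matrix.conjTranspose_one, one_mul, Matrix.one_kronecker_one]

theorem cyclicBlock_pow_unitary (k r m : ℕ) :
    (cyclicBlock k r ^ m)ᴴ * cyclicBlock k r ^ m = 1 := by
  induction m with
  | zero => simp
  | succ m ih =>
    rw [pow_succ', Matrix.conjTranspose_mul, Matrix.mul_assoc,
      ← Matrix.mul_assoc _ (cyclicBlock k r), cyclicBlock_unitary, one_mul, ih]

theorem conjTranspose_cyclicBlock_pow_mul {k : ℕ} [NeZero k] (r : ℕ) (i j : Fin k) :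
    (cyclicBlock k r ^ (i : ℕ))ᴴ * cyclicBlock k r ^ (j : ℕ) =
      cyclicBlock k r ^ ((j - i : Fin k) : ℕ) := by
  have h : cyclicBlock k r ^ (j : ℕ) =
      cyclicBlock k r ^ (i : ℕ) * cyclicBlock k r ^ ((j - i : Fin k) : ℕ) := by
    have hj : (j : ℕ) = ((i : ℕ) + ((j - i : Fin k) : ℕ)) % k := by
      rw [← Fin.val_add, add_sub_cancel]
    rw [← pow_add, ← Nat.div_add_mod ((i : ℕ) + ((j - i : Fin k) : ℕ)) k, ← hj, pow_add, pow_mul,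
      cyclicBlock_pow_self, one_pow, one_mul]
  rw [h, ← mul_assoc, cyclicBlock_pow_unitary, one_mul]

/-! ### The block states -/

section Block

variable {n : ℕ}

theorem circle_star_mul_self (α : Circle) : star (α : ℂ) * (α : ℂ) = 1 := by
  rw [RCLike.star_def, ← Circle.coe_inv_eq_conj, ← Circle.coe_mul, inv_mul_cancel, Circle.coe_one]

theorem conjTranspose_blockUnitary_mul (k r : ℕ) (α β : Circle) (p q : Fin n → Fin 4) (i j : ℕ) :
    (blockUnitary k r α p i)ᴴ * blockUnitary k r β q j =
      Matrix.reindex (blockEquiv n k r) (blockEquiv n k r)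
        (Matrix.fromBlocks ((star (α : ℂ) * β) • (pauliString p * pauliString q)) 0 0
          ((cyclicBlock k r ^ i)ᴴ * cyclicBlock k r ^ j)) := by
  rw [blockUnitary, blockUnitary, Matrix.conjTranspose_reindex, Matrix.reindex_apply,
    Matrix.reindex_apply, Matrix.submatrix_mul_equiv, Matrix.fromBlocks_conjTranspose,
    Matrix.fromBlocks_multiply, Matrix.conjTranspose_smul, pauliString_conjTranspose]
  simp [smul_smul, mul_comm]

theorem blockUnitary_unitary (k r : ℕ) (α : Circle) (p : Fin n → Fin 4) (i : ℕ) :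
    (blockUnitary k r α p i)ᴴ * blockUnitary k r α p i = 1 := by
  rw [conjTranspose_blockUnitary_mul, circle_star_mul_self, pauliString_mul_self,
    cyclicBlock_pow_unitary, one_smul, Matrix.fromBlocks_one]
  simp

theorem trace_conjTranspose_blockUnitary_mul {k : ℕ} [NeZero k] (r : ℕ) (α β : Circle)
    {p q : Fin n → Fin 4} (hpq : p ≠ q) {i j : Fin k} (hij : i ≠ j) :
    ((blockUnitary k r α p i)ᴴ * blockUnitary k r β q j).trace = 0 := by
  have htrace (M : Matrix _ _ ℂ) :
      (Matrix.reindex (blockEquiv n k r) (blockEquiv n k r) M).trace = M.trace :=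
    (blockEquiv n k r).symm.sum_comp M.diag
  rw [conjTranspose_blockUnitary_mul, htrace, Matrix.trace, Fintype.sum_sum_type]
  change Matrix.trace ((star (α : ℂ) * β) • (pauliString p * pauliString q)) +
    Matrix.trace ((cyclicBlock k r ^ (i : ℕ))ᴴ * cyclicBlock k r ^ (j : ℕ)) = 0
  rw [Matrix.trace_smul, trace_pauliString_mul_pauliString hpq,
    conjTranspose_cyclicBlock_pow_mul, trace_cyclicBlock_pow r _ (Fin.isLt _), smul_zero, add_zero]
  exact Nat.pos_of_ne_zero fun h => hij (sub_eq_zero.mp (Fin.ext h)).symm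

theorem overlap_blockUnitary {k : ℕ} [NeZero k] (r : ℕ) (α : Fin k → Circle)
    (p : Fin k → Fin n → Fin 4) (φ : Fin (2 ^ n + k * r) → ℂ) (i j : Fin k) :
    star (blockUnitary k r (α i) (p i) i *ᵥ φ) ⬝ᵥ (blockUnitary k r (α j) (p j) j *ᵥ φ) =
      star (α i : ℂ) * α j *
        (star (pauliString (p i) *ᵥ (φ ∘ blockEquiv n k r ∘ Sum.inl)) ⬝ᵥ
          (pauliString (p j) *ᵥ (φ ∘ blockEquiv n k r ∘ Sum.inl))) +
      star (φ ∘ blockEquiv n k r ∘ Sum.inr) ⬝ᵥ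
        (cyclicBlock k r ^ ((j - i : Fin k) : ℕ) *ᵥ (φ ∘ blockEquiv n k r ∘ Sum.inr)) := by
  rw [Matrix.star_mulVec, ← Matrix.dotProduct_mulVec, Matrix.mulVec_mulVec,
    conjTranspose_blockUnitary_mul, Matrix.star_mulVec, ← Matrix.dotProduct_mulVec,
    Matrix.mulVec_mulVec, pauliString_conjTranspose, conjTranspose_cyclicBlock_pow_mul,
    Matrix.reindex_apply, Matrix.submatrix_mulVec_equiv, Matrix.fromBlocks_mulVec,
    dotProduct_comp_equiv_symm, Matrix.zero_mulVec, Matrix.zero_mulVec, add_zero, zero_add,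
    Matrix.smul_mulVec, dotProduct, Fintype.sum_sum_type, dotProduct, Finset.mul_sum]
  refine congrArg₂ _ (Finset.sum_congr rfl fun a _ => ?_) rfl
  exact mul_left_comm _ _ _

theorem isMaximallyEntangled_blockState (k r : ℕ) (α : Fin k → Circle)
    (p : Fin k → Fin n → Fin 4) (i : Fin k) : IsMaximallyEntangled (blockState k r α p i) :=
  isMaximallyEntangled_stateOf (blockUnitary_unitary k r (α i) (p i) i)

theorem orthonormal_blockState {k : ℕ} [NeZero k] (r : ℕ) (α : Fin k → Circle)
    {p : Fin k → Fin n → Fin 4} (hp : Function.Injective p) :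
    Orthonormal ℂ (blockState k r α p) :=
  have : Nonempty (Fin (2 ^ n + k * r)) := ⟨blockEquiv n k r (Sum.inl 0)⟩
  orthonormal_stateOf (fun i => blockUnitary_unitary k r (α i) (p i) i) fun _ _ hij =>
    trace_conjTranspose_blockUnitary_mul r _ _ (hp.ne hij) hij

theorem pptDistinguishable_blockState {k r : ℕ} [NeZero k] (hr : 2 ≤ r) (α : Fin k → Circle)
    {p : Fin k → Fin n → Fin 4} (hp : Function.Injective p) :
    PPTDistinguishable (blockState k r α p) := by
  refine pptDistinguishable_stateOf (fun i => blockUnitary_unitary k r (α i) (p i) i)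
    (orthonormal_blockState r α hp) ?_
  simp only [Fintype.card_fin]
  calc 2 * k = k * 2 := mul_comm 2 k
    _ ≤ k * r := Nat.mul_le_mul_left k hr
    _ ≤ 2 ^ n + k * r := Nat.le_add_left _ _

end Block

/-- The phases `e^(iπ/4), 1, 1, …`. -/
noncomputable def twistPhase {k : ℕ} [NeZero k] (i : Fin k) : Circle :=
  if i = 0 then Circle.exp (Real.pi / 4) else 1

theorem circle_exp_pi_div_four_sq :
    (Circle.exp (Real.pi / 4) : ℂ) * (Circle.exp (Real.pi / 4) : ℂ) = Complex.I := by
  rw [← Circle.coe_mul, ← Circle.exp_add, Circle.coe_exp]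
  refine Eq.trans (congrArg Complex.exp ?_) Complex.exp_pi_div_two_mul_I
  push_cast
  ring

theorem eq_zero_of_star_phase_mul_eq {g h : ℂ} (hg : star g * star g = g * g)
    (hh : star h * star h = h * h) (hgh : star (Circle.exp (Real.pi / 4) : ℂ) * g = h) :
    h = 0 := by
  have hω := circle_exp_pi_div_four_sq
  set ω : ℂ := (Circle.exp (Real.pi / 4) : ℂ)
  have hω' : star ω * star ω = -Complex.I := by
    rw [← star_mul', hω, RCLike.star_def, Complex.conj_I]
  have h1 : h * h = -Complex.I * (g * g) := by
    rw [← hgh, ← hω']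
    ring
  have h2 : h * h = Complex.I * (g * g) := by
    rw [← hh, ← hgh, star_mul', star_star, ← hω, ← hg]
    ring
  have h3 : h * h = 0 := by linear_combination (h1 + h2) / 2
  exact mul_self_eq_zero.mp h3

/-- A vector mapped to pairwise orthogonal vectors by the block unitaries has no component in the
first block, since circulant overlaps are incompatible with the phases. -/
theorem comp_inl_eq_zero_of_orthogonal {n k : ℕ} [NeZero k] (hk : 3 ≤ k) (hn : 2 ^ n < k) (r : ℕ)
    (p : Fin k → Fin n → Fin 4) {φ : Fin (2 ^ n + k * r) → ℂ}
    (hφ : ∀ i j : Fin k, i ≠ j → star (blockUnitary k r (twistPhase i) (p i) i *ᵥ φ) ⬝ᵥ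
      (blockUnitary k r (twistPhase j) (p j) j *ᵥ φ) = 0) :
    φ ∘ blockEquiv n k r ∘ Sum.inl = 0 := by
  refine eq_zero_of_orthogonal_of_card_lt (κ := Fin k) (by simpa using hn)
    (fun i => pauliString_unitary (p i)) fun i j hij => ?_
  set u := φ ∘ blockEquiv n k r ∘ Sum.inl
  set v := φ ∘ blockEquiv n k r ∘ Sum.inr
  have hoverlap (i j : Fin k) (hij : i ≠ j) : star (twistPhase i : ℂ) * twistPhase j *
      (star (pauliString (p i) *ᵥ u) ⬝ᵥ (pauliString (p j) *ᵥ u)) =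
      -(star v ⬝ᵥ (cyclicBlock k r ^ ((j - i : Fin k) : ℕ) *ᵥ v)) := by
    rw [eq_neg_iff_add_eq_zero, ← overlap_blockUnitary r twistPhase p φ i j]
    exact hφ i j hij
  have hd : j - i ≠ 0 := sub_ne_zero.mpr hij.symm
  obtain ⟨l, hl⟩ : ∃ l, l ∉ ({0, -(j - i)} : Finset (Fin k)) := by
    by_contra! hall
    have h1 := Finset.card_le_card (fun l _ => hall l : Finset.univ ⊆ _)
    have h2 := Finset.card_le_two (a := (0 : Fin k)) (b := -(j - i))
    rw [Finset.card_univ, Fintype.card_fin] at h1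
    omega
  simp only [Finset.mem_insert, Finset.mem_singleton, not_or] at hl
  have hl2 : l + (j - i) ≠ 0 := fun h => hl.2 (eq_neg_of_add_eq_zero_left h)
  have h0 := hoverlap 0 (j - i) hd.symm
  have h1 := hoverlap l (l + (j - i)) (by simpa using hd)
  rw [sub_zero] at h0
  rw [add_sub_cancel_left, ← h0] at h1
  simp only [twistPhase, hl.1, hl2, hd, if_false, if_true, Circle.coe_one, star_one, mul_one,
    one_mul] at h1
  have h2 := eq_zero_of_star_phase_mul_eq (star_overlap_mul_self _ _ _)
    (star_overlap_mul_self _ _ _) h1.symm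
  have h3 := hoverlap i j hij
  rw [← h0] at h3
  simp only [twistPhase, hd, if_false, if_true, Circle.coe_one, mul_one, ← h1, h2] at h3
  refine (mul_eq_zero.mp h3).resolve_left (mul_ne_zero ?_ ?_)
  · exact star_ne_zero.mpr (Circle.coe_ne_zero _)
  · exact Circle.coe_ne_zero _

theorem not_oneWayLOCCDistinguishable_blockState {n k : ℕ} [NeZero k] (hk : 3 ≤ k)
    (hn : 2 ^ n < k) (r : ℕ) (p : Fin k → Fin n → Fin 4) :
    ¬ OneWayLOCCDistinguishable (blockState k r twistPhase p) :=
  not_oneWayLOCCDistinguishable_stateOf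
    (U := fun i : Fin k => blockUnitary k r (twistPhase i) (p i) i)
    (blockEquiv n k r (Sum.inl 0)) fun _ hφ =>
      congrFun (comp_inl_eq_zero_of_orthogonal hk hn r p hφ) 0

theorem exists_two_pow_lt_and_le_four_pow {k : ℕ} (hk : 3 ≤ k) :
    ∃ n, 2 ^ n < k ∧ k ≤ 4 ^ n := by
  have h1 : 2 ^ Nat.log 2 (k - 1) ≤ k - 1 := Nat.pow_log_le_self 2 (by omega)
  have h2 : k - 1 < 2 ^ (Nat.log 2 (k - 1) + 1) := Nat.lt_pow_succ_log_self one_lt_two _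
  have h3 : 1 ≤ Nat.log 2 (k - 1) := Nat.log_pos one_lt_two (by omega)
  refine ⟨Nat.log 2 (k - 1), by omega, ?_⟩
  calc k ≤ 2 ^ (Nat.log 2 (k - 1) + 1) := by omega
    _ ≤ 2 ^ (2 * Nat.log 2 (k - 1)) := Nat.pow_le_pow_right two_pos (by omega)
    _ = 4 ^ Nat.log 2 (k - 1) := by rw [pow_mul]; norm_num

end LocalDiscrimination

theorem mainTheorem7 (k : ℕ) (hk : 3 ≤ k) (D : ℕ) :
    ∃ (n r : ℕ) (p : Fin k → Fin n → Fin 4) (α : Fin k → Circle),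
      1 ≤ r ∧ D ≤ 2 ^ n + k * r ∧
      Function.Injective p ∧
      ¬ LocalDiscrimination.OneWayLOCCDistinguishable
          (fun i => LocalDiscrimination.latticeState (p i)) ∧
      Orthonormal ℂ (LocalDiscrimination.blockState k r α p) ∧
      (∀ i, LocalDiscrimination.IsMaximallyEntangled
          (LocalDiscrimination.blockState k r α p i)) ∧
      LocalDiscrimination.PPTDistinguishable (LocalDiscrimination.blockState k r α p) ∧
      ¬ LocalDiscrimination.OneWayLOCCDistinguishable
          (LocalDiscrimination.blockState k r α p) := by
  have : NeZero k := ⟨by omega⟩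
  obtain ⟨n, hn, hn'⟩ := LocalDiscrimination.exists_two_pow_lt_and_le_four_pow hk
  obtain ⟨p⟩ : Nonempty (Fin k ↪ (Fin n → Fin 4)) :=
    Function.Embedding.nonempty_of_card_le (by simpa using hn')
  refine ⟨n, D + 2, p, LocalDiscrimination.twistPhase, by omega, ?_, p.injective,
    LocalDiscrimination.not_oneWayLOCCDistinguishable_latticeState (by simpa using hn) p,
    LocalDiscrimination.orthonormal_blockState _ _ p.injective,
    LocalDiscrimination.isMaximallyEntangled_blockState _ _ _ _,
    LocalDiscrimination.pptDistinguishable_blockState (by omega) _ p.injective,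
    LocalDiscrimination.not_oneWayLOCCDistinguishable_blockState hk hn _ p⟩
  calc D ≤ D + 2 := Nat.le_add_right _ _
    _ ≤ k * (D + 2) := Nat.le_mul_of_pos_left _ (by omega)
    _ ≤ 2 ^ n + k * (D + 2) := Nat.le_add_left _ _
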